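/- Let $n,m,k$ be nonnegative integers, let $D\subseteq\mathbb R^m$ be non-empty, and write $\mathbb R_+=[0,\infty)$ and $|\cdot|$ for the Euclidean norm. Let $f:\mathbb R^n\times D\to\mathbb R^n$ be continuous with $f(0,d)=0$ for all $d\in D$, and such that for every compact $S\subseteq\mathbb R^n$ and every bounded $K\subseteq D$ there is $L>0$ with $|f(x,d)-f(z,d)|\le L|x-z|$ for all $x,z\in S$, $d\in K$. Let $h:\mathbb R^n\to\mathbb R^k$ be continuous with $h(0)=0$. Consider the system $\dot x=f(x,d)$, $y=h(x)$, with inputs $d\in L^\infty_{loc}(\mathbb R_+;D)$ (measurable, locally essentially bounded), and assume that it is forward complete: for all $x_0\in\mathbb R^n$ and all inputs $d$, the (unique, Carathéodory) solution $\phi(t,x_0;d)$ with $\phi(0,x_0;d)=x_0$ exists for all $t\ge0$. Put $y(t,x_0;d)=h(\phi(t,x_0;d))$. The system is called - *uniformly robustly globally output attractive (URGOA)* if for all $\varepsilon,R>0$ there is $T>0$ such that $|y(t,x_0;d)|\le\varepsilon$ for all inputs $d$, all $|x_0|\le R$ and all $t\ge T$; - *robustly Lyapunov output stable* if for every $\varepsilon>0$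 there is $\delta>0$ such that $|y(t,x_0;d)|\le\varepsilon$ for all inputs $d$, all $|x_0|\le\delta$ and all $t\ge0$; - *robustly Lagrange output stable* if for every $\delta>0$ there is $\varepsilon>0$ such that $|y(t,x_0;d)|\le\varepsilon$ for all inputs $d$, all $|x_0|\le\delta$ and all $t\ge0$; - *uniformly robustly globally asymptotically output stable (URGAOS)* if it has all three of these properties. Class $\mathcal K$ consists of the continuous strictly increasing $\alpha:\mathbb R_+\to\mathbb R_+$ with $\alpha(0)=0$, and $\mathcal K_\infty$ of those that moreover tend to $+\infty$. **Theorem 1.** Suppose that there are $V,W\in C^1(\mathbb R^n;\mathbb R_+)$ and a continuous $\rho:\mathbb R_+\to\mathbb R_+$ with $\rho(0)=0$ and $\rho(s)>0$ for $s>0$ such that $$\nabla V(x)f(x,d)\le-\rho(W(x))\qquad\text{for all }x\in\mathbb R^n,\ d\in D.$$ Suppose also that, for some constant $r>0$ and some $a\in\mathcal K$, for all $x\in\mathbb R^n$ with $W(x)<r$ and all $d\in D$, $$a(|h(x)|)\le W(x),\qquad \nabla W(x)f(x,d)\le0.$$ Assume that at least one of the following holds: i) $\liminf_{s\to+\infty}\rho(s)>0$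 (the value $+\infty$ being allowed); ii) there are $\zeta\in\mathcal K_\infty$ and $Q\in C^1(\mathbb R^n;\mathbb R_+)$ such that $W(x)\le\zeta(Q(x))$ and $\nabla Q(x)f(x,d)\le0$ for all $x\in\mathbb R^n$, $d\in D$. Then the system is URGOA and robustly Lyapunov output stable. If, in addition, $D$ is compact and for every compact $S\subseteq\mathbb R^n$ there is $L_S>0$ with $|f(x,d)-f(z,e)|\le L_S(|x-z|+|d-e|)$ for all $x,z\in S$ and $d,e\in D$, then the system is URGAOS. -/

import Mathlib

open Set Filter Topology MeasureTheory

namespace OutputStability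

/-- `ℝⁿ` with the Euclidean norm. -/
abbrev E (n : ℕ) : Type := EuclideanSpace ℝ (Fin n)

/-- Class `𝒦`: continuous (strictly) increasing functions `a : [0,∞) → [0,∞)` with `a 0 = 0`.
Only the values on `[0,∞)` matter; nonnegativity there follows from monotonicity. -/
def ClassK (a : ℝ → ℝ) : Prop :=
  ContinuousOn a (Ici 0) ∧ StrictMonoOn a (Ici 0) ∧ a 0 = 0

/-- Class `𝒦∞`: functions of class `𝒦` that tend to infinity. -/
def ClassKInf (a : ℝ → ℝ) : Prop :=
  ClassK a ∧ Tendsto a atTop atTop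

/-- Continuous positive definite functions `ρ : [0,∞) → [0,∞)`. -/
def ContPosDef (ρ : ℝ → ℝ) : Prop :=
  ContinuousOn ρ (Ici 0) ∧ ρ 0 = 0 ∧ ∀ s : ℝ, 0 < s → 0 < ρ s

/-- `C¹(ℝⁿ; [0,∞))`. -/
def C1Nonneg {n : ℕ} (V : E n → ℝ) : Prop :=
  ContDiff ℝ 1 V ∧ ∀ x, 0 ≤ V x

section System

variable {n m k : ℕ} {D : Set (E m)}

/-- The derivative `∇V(x) f(x,d)` of `V` along the vector field `f(·,d)` at `x`. -/
noncomputable def lieDeriv (f : E n × D → E n) (V : E n → ℝ) (x : E n) (d : D) : ℝ :=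
  fderiv ℝ V x (f (x, d))

/-- `f` is locally Lipschitz in the state, uniformly over bounded sets of inputs. -/
def LocLipState (f : E n × D → E n) : Prop :=
  ∀ S : Set (E n), IsCompact S → ∀ K : Set (E m), K ⊆ D → Bornology.IsBounded K →
    ∃ L : ℝ, 0 < L ∧ ∀ x ∈ S, ∀ z ∈ S, ∀ d : D, (d : E m) ∈ K →
      ‖f (x, d) - f (z, d)‖ ≤ L * ‖x - z‖

/-- Compact input set, and `f` locally Lipschitz in the state and the input jointly. -/
def CompactLipschitz (f : E n × D → E n) : Prop :=
  IsCompact D ∧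
  ∀ S : Set (E n), IsCompact S →
    ∃ L : ℝ, 0 < L ∧ ∀ x ∈ S, ∀ z ∈ S, ∀ d e : D,
      ‖f (x, d) - f (z, e)‖ ≤ L * (‖x - z‖ + ‖(d : E m) - (e : E m)‖)

/-- `d ∈ L^∞_loc([0,∞); D)`: (Lebesgue) measurable and locally essentially bounded on `[0,∞)`.
The values of `d` at negative times play no role anywhere. -/
def IsInput (d : ℝ → D) : Prop :=
  AEMeasurable d (volume.restrict (Ici (0 : ℝ))) ∧
  ∀ T : ℝ, ∃ M : ℝ, ∀ᵐ t ∂(volume.restrict (Icc (0 : ℝ) T)), ‖(d t : E m)‖ ≤ M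

/-- `x` is a (Carathéodory) solution on `[0,∞)` of `ẋ = f(x,d)`, `x(0) = x₀`.
The values of `x` at negative times play no role. -/
def IsSolution (f : E n × D → E n) (d : ℝ → D) (x₀ : E n) (x : ℝ → E n) : Prop :=
  ContinuousOn x (Ici 0) ∧
  ∀ t : ℝ, 0 ≤ t →
    IntervalIntegrable (fun s => f (x s, d s)) volume 0 t ∧
    x t = x₀ + ∫ s in (0 : ℝ)..t, f (x s, d s)

/-- Forward completeness: a solution on all of `[0,∞)` for every initial state and input. -/
def ForwardComplete (f : E n × D → E n) : Prop :=
  ∀ (x₀ : E n) (d : ℝ → D), IsInput d → ∃ x : ℝ → E n, IsSolution f d x₀ x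

/-- Uniform robust global output attractivity. -/
def URGOA (f : E n × D → E n) (h : E n → E k) : Prop :=
  ∀ ε : ℝ, 0 < ε → ∀ R : ℝ, 0 < R → ∃ T : ℝ, 0 < T ∧
    ∀ d : ℝ → D, IsInput d → ∀ x₀ : E n, ‖x₀‖ ≤ R →
      ∀ x : ℝ → E n, IsSolution f d x₀ x → ∀ t : ℝ, T ≤ t → ‖h (x t)‖ ≤ ε

/-- Robust Lyapunov output stability. -/
def LyapunovOutputStable (f : E n × D → E n) (h : E n → E k) : Prop :=
  ∀ ε : ℝ, 0 < ε → ∃ δ : ℝ, 0 < δ ∧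
    ∀ d : ℝ → D, IsInput d → ∀ x₀ : E n, ‖x₀‖ ≤ δ →
      ∀ x : ℝ → E n, IsSolution f d x₀ x → ∀ t : ℝ, 0 ≤ t → ‖h (x t)‖ ≤ ε

/-- Robust Lagrange output stability. -/
def LagrangeOutputStable (f : E n × D → E n) (h : E n → E k) : Prop :=
  ∀ δ : ℝ, 0 < δ → ∃ ε : ℝ, 0 < ε ∧
    ∀ d : ℝ → D, IsInput d → ∀ x₀ : E n, ‖x₀‖ ≤ δ →
      ∀ x : ℝ → E n, IsSolution f d x₀ x → ∀ t : ℝ, 0 ≤ t → ‖h (x t)‖ ≤ ε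

/-- Uniform robust global asymptotic output stability. -/
def URGAOS (f : E n × D → E n) (h : E n → E k) : Prop :=
  LagrangeOutputStable f h ∧ LyapunovOutputStable f h ∧ URGOA f h

end System

end OutputStability

namespace OutputStability

open Metric

/-! ### Absolutely continuous solutions and decay of functions along them. -/

section Dissipation

variable {n m k : ℕ} {D : Set (E m)} {f : E n × D → E n}

/-! In `{W < r}` the function `W` bounds `a ‖h‖` and cannot increase along solutions, so a solution
that enters `{W < min r (a ε)}` keeps its output below `ε` from then on
(`IsSolution.norm_output_le`). For attractivity, `V` falls while `W ≥ η` at a rate that is uniform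
over a ball of initial states and all inputs (`exists_decay_rate`); as `V ≥ 0`, this lasts only a
bounded time. For Lyapunov stability, dissipation at the equilibrium forces `W 0 = 0`, so states
near `0` already start in the trapping region.

For Lagrange stability, attractivity bounds the output after some time `T`, and before `T` it
suffices that reachable sets are bounded (`exists_bound_solution`). Forward completeness only bounds
each solution separately. If the reachable set of a ball were unbounded, then by compactness
solutions would escape near a single state. Flow maps are open, because for short times they are
uniformly close to the identity. Hence an input can be prolonged so that a whole smaller compact set
of initial states is carried beyond norm `j`, with escape persisting near a state reached. The
nested compact sets have a common point and the inputs a common extension; the resulting solution is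
unbounded before `T`, which is absurd. -/

theorem IsSolution.apply_zero {d : ℝ → D} {x₀ : E n} {x : ℝ → E n}
    (hx : IsSolution f d x₀ x) : x 0 = x₀ := by
  simpa using (hx.2 0 le_rfl).2

theorem IsSolution.intervalIntegrable {d : ℝ → D} {x₀ : E n} {x : ℝ → E n}
    (hx : IsSolution f d x₀ x) {a b : ℝ} (ha : 0 ≤ a) (hb : 0 ≤ b) :
    IntervalIntegrable (fun s => f (x s, d s)) volume a b :=
  (hx.2 a ha).1.symm.trans (hx.2 b hb).1

theorem IsSolution.eq_add_integral {d : ℝ → D} {x₀ : E n} {x : ℝ → E n}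
    (hx : IsSolution f d x₀ x) {a b : ℝ} (ha : 0 ≤ a) (hb : 0 ≤ b) :
    x b = x a + ∫ s in a..b, f (x s, d s) := by
  rw [(hx.2 a ha).2, (hx.2 b hb).2, add_assoc,
    intervalIntegral.integral_add_adjacent_intervals (hx.2 a ha).1 (hx.intervalIntegrable ha hb)]

theorem IsSolution.ae_hasDerivAt {d : ℝ → D} {x₀ : E n} {x : ℝ → E n}
    (hx : IsSolution f d x₀ x) {a b : ℝ} (ha : 0 ≤ a) (hab : a ≤ b) :
    ∀ᵐ t, t ∈ Icc a b → HasDerivAt x (f (x t, d t)) t := by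
  -- The integral equation holds only for nonnegative times, so no two-sided derivative is available
  -- at `0`.
  have h0 : ∀ᵐ t : ℝ, t ≠ 0 := by simp [ae_iff, measure_singleton]
  filter_upwards [(hx.intervalIntegrable ha (ha.trans hab)).ae_hasDerivAt_integral, h0]
    with t ht ht0 hmem
  rw [uIcc_of_le hab] at ht
  have h1 := (ht hmem a (left_mem_Icc.2 hab)).const_add (x a)
  refine h1.congr_of_eventuallyEq ?_
  have htpos : 0 < t := lt_of_le_of_ne (ha.trans hmem.1) (Ne.symm ht0)
  filter_upwards [Ioi_mem_nhds htpos] with s hs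
  exact hx.eq_add_integral ha (le_of_lt hs)

/-- The increments of `x` are dominated by those of a primitive of `‖f (x, d)‖`, which is absolutely
continuous. -/
theorem IsSolution.absolutelyContinuous {d : ℝ → D} {x₀ : E n} {x : ℝ → E n}
    (hx : IsSolution f d x₀ x) {a b : ℝ} (ha : 0 ≤ a) (hab : a ≤ b) :
    AbsolutelyContinuousOnInterval x a b := by
  have hint := hx.intervalIntegrable ha (ha.trans hab)
  have h1 := hint.norm.absolutelyContinuousOnInterval_intervalIntegral (c := a) (by simp)
  rw [absolutelyContinuousOnInterval_iff] at h1 ⊢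
  intro ε hε
  obtain ⟨δ, hδ, H⟩ := h1 ε hε
  refine ⟨δ, hδ, fun I hI hlt => lt_of_le_of_lt (Finset.sum_le_sum fun i hi => ?_) (H I hI hlt)⟩
  have h2 := hI.1 i hi
  rw [uIcc_of_le hab] at h2
  have h3 := ha.trans h2.1.1
  have h4 := ha.trans h2.2.1
  rw [dist_comm, dist_comm (∫ t in a..(I.2 i).1, _), hx.eq_add_integral h3 h4, dist_eq_norm,
    add_sub_cancel_left, Real.dist_eq, intervalIntegral.integral_interval_sub_left
      (hx.intervalIntegrable ha h4).norm (hx.intervalIntegrable ha h3).norm]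
  exact intervalIntegral.norm_integral_le_abs_integral_norm

theorem _root_.AbsolutelyContinuousOnInterval.lipschitzOnWith_comp {X Y : Type*}
    [PseudoMetricSpace X] [PseudoMetricSpace Y] {x : ℝ → X} {a b : ℝ}
    (hx : AbsolutelyContinuousOnInterval x a b) {g : X → Y} {K : NNReal} {s : Set X}
    (hg : LipschitzOnWith K g s) (hs : MapsTo x (uIcc a b) s) :
    AbsolutelyContinuousOnInterval (fun t => g (x t)) a b := by
  rw [absolutelyContinuousOnInterval_iff] at hx ⊢
  intro ε hε
  have hK : (0 : ℝ) < K + 1 := by positivity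
  obtain ⟨δ, hδ, H⟩ := hx (ε / (K + 1)) (by positivity)
  refine ⟨δ, hδ, fun I hI hlt => ?_⟩
  have h1 := H I hI hlt
  rw [lt_div_iff₀ hK, Finset.sum_mul] at h1
  refine lt_of_le_of_lt (Finset.sum_le_sum fun i hi => ?_) h1
  have h2 := hI.1 i hi
  have h3 := hg.dist_le_mul _ (hs h2.1) _ (hs h2.2)
  nlinarith [dist_nonneg (x := x (I.2 i).1) (y := x (I.2 i).2)]

/-- A `C¹` function whose derivative along the vector field is at most `-c` on a time interval
decreases there at least at rate `c`. -/
theorem IsSolution.le_sub_of_lieDeriv_le {d : ℝ → D} {x₀ : E n} {x : ℝ → E n}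
    (hx : IsSolution f d x₀ x) {U : E n → ℝ} (hU : ContDiff ℝ 1 U) {a b c : ℝ} (ha : 0 ≤ a)
    (hab : a ≤ b) (hc : ∀ t ∈ Icc a b, lieDeriv f U (x t) (d t) ≤ -c) :
    U (x b) ≤ U (x a) - c * (b - a) := by
  have hcont : ContinuousOn x (Icc a b) := hx.1.mono fun t ht => ha.trans ht.1
  obtain ⟨R, hR⟩ := (isCompact_Icc.image_of_continuousOn hcont).isBounded.subset_closedBall 0
  obtain ⟨K, hK⟩ := (hU.contDiffOn (s := closedBall 0 R)).exists_lipschitzOnWith (by decide)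
    (convex_closedBall _ _) (isCompact_closedBall _ _)
  have hac : AbsolutelyContinuousOnInterval (fun t => U (x t)) a b := by
    refine (hx.absolutelyContinuous ha hab).lipschitzOnWith_comp hK ?_
    rw [uIcc_of_le hab]
    exact fun t ht => hR (mem_image_of_mem x ht)
  have hder : ∀ᵐ t, t ∈ Icc a b → deriv (fun t => U (x t)) t ≤ -c := by
    filter_upwards [hx.ae_hasDerivAt ha hab] with t ht hmem
    have h1 : HasFDerivAt U (fderiv ℝ U (x t)) (x t) :=
      (hU.differentiable (by decide) (x t)).hasFDerivAt
    exact (h1.comp_hasDerivAt t (ht hmem)).deriv.trans_le (hc t hmem)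
  have hint := intervalIntegral.integral_mono_ae_restrict hab hac.intervalIntegrable_deriv
    (intervalIntegrable_const (c := -c)) ((ae_restrict_iff' measurableSet_Icc).2 hder)
  rw [hac.integral_deriv_eq_sub, intervalIntegral.integral_const, smul_eq_mul] at hint
  linarith

/-- If `W` ended higher, it would first reach some level `c < r` above its initial value. Up to that
time it stays below `r`, so it cannot have increased. -/
theorem IsSolution.sublevel_antitone {d : ℝ → D} {x₀ : E n} {x : ℝ → E n}
    (hx : IsSolution f d x₀ x) {W : E n → ℝ} (hW : ContDiff ℝ 1 W) {r : ℝ}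
    (hdec : ∀ x : E n, W x < r → ∀ d : D, lieDeriv f W x d ≤ 0) {a b : ℝ} (ha : 0 ≤ a)
    (hab : a ≤ b) (hr : W (x a) < r) : W (x b) ≤ W (x a) := by
  by_contra! hlt
  obtain ⟨c, hc1, hc2⟩ := exists_between (lt_min hr hlt)
  rw [lt_min_iff] at hc2
  have hcont : ContinuousOn (fun t => W (x t)) (Icc a b) :=
    hW.continuous.comp_continuousOn (hx.1.mono fun t ht => ha.trans ht.1)
  have hclosed : IsCompact (Icc a b ∩ (fun t => W (x t)) ⁻¹' {c}) :=
    isCompact_Icc.of_isClosed_subset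
      (hcont.preimage_isClosed_of_isClosed isClosed_Icc isClosed_singleton) inter_subset_left
  obtain ⟨τ₀, hτ₀, hτ₀c⟩ := intermediate_value_Icc hab hcont ⟨hc1.le, hc2.2.le⟩
  obtain ⟨τ, ⟨hτ, hτc⟩, hleast⟩ := hclosed.exists_isLeast ⟨τ₀, hτ₀, hτ₀c⟩
  have hbelow : ∀ t ∈ Icc a τ, W (x t) < r := by
    intro t ht
    by_contra! hge
    obtain ⟨σ, hσ, hσc⟩ := intermediate_value_Icc ht.1
      (hcont.mono (Icc_subset_Icc_right (ht.2.trans hτ.2))) ⟨hc1.le, hc2.1.le.trans hge⟩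
    have h1 := hleast ⟨⟨hσ.1, hσ.2.trans (ht.2.trans hτ.2)⟩, hσc⟩
    have h2 : t = τ := le_antisymm ht.2 (h1.trans hσ.2)
    subst h2
    exact absurd hc2.1 (not_lt.2 (hge.trans_eq hτc))
  have h3 := hx.le_sub_of_lieDeriv_le (c := 0) hW ha hτ.1 fun t ht => by
    simpa using hdec (x t) (hbelow t ht) (d t)
  have h4 : W (x τ) = c := hτc
  linarith

end Dissipation

/-! ### Attractivity and Lyapunov stability of the output. -/

section Attractivity

variable {n m k : ℕ} {D : Set (E m)} {f : E n × D → E n}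

theorem ContPosDef.exists_pos_le {ρ : ℝ → ℝ} (hρ : ContPosDef ρ) {η : ℝ} (hη : 0 < η) (M : ℝ) :
    ∃ c, 0 < c ∧ ∀ s ∈ Icc η M, c ≤ ρ s :=
  isCompact_Icc.exists_forall_le' (hρ.1.mono fun _ hs => hη.le.trans hs.1)
    fun s hs => hρ.2.2 s (hη.trans_le hs.1)

/-- Along solutions from a bounded set, the decay rate `ρ (W x)` is bounded below as long as `W x`
is. -/
theorem exists_decay_rate {W : E n → ℝ} {ρ : ℝ → ℝ} (hρ : ContPosDef ρ)
    (hcond :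
      0 < liminf (fun s : ℝ => ((ρ s : ℝ) : EReal)) atTop ∨
      ∃ (ζ : ℝ → ℝ) (Q : E n → ℝ), ClassKInf ζ ∧ C1Nonneg Q ∧ (∀ x : E n, W x ≤ ζ (Q x)) ∧
        ∀ (x : E n) (d : D), lieDeriv f Q x d ≤ 0) {η : ℝ} (hη : 0 < η) (R : ℝ) :
    ∃ c, 0 < c ∧ ∀ d : ℝ → D, ∀ x₀ : E n, ‖x₀‖ ≤ R → ∀ x : ℝ → E n, IsSolution f d x₀ x →
      ∀ t, 0 ≤ t → η ≤ W (x t) → c ≤ ρ (W (x t)) := by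
  rcases hcond with hlim | ⟨ζ, Q, hζ, hQ, hWQ, hQdec⟩
  -- Beyond `N` the limit inferior bounds `ρ` below; on `[η, N]` compactness does.
  · obtain ⟨c₁, hc₁, hc₁'⟩ := EReal.lt_iff_exists_real_btwn.1 hlim
    obtain ⟨N, hN⟩ := eventually_atTop.1 (eventually_lt_of_lt_liminf hc₁')
    obtain ⟨c₂, hc₂, hc₂'⟩ := hρ.exists_pos_le hη N
    refine ⟨min c₁ c₂, lt_min (by exact_mod_cast hc₁) hc₂, fun d x₀ _ x _ t _ ht => ?_⟩
    rcases le_total (W (x t)) N with h1 | h1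
    · exact (min_le_right _ _).trans (hc₂' _ ⟨ht, h1⟩)
    · exact (min_le_left _ _).trans (EReal.coe_lt_coe_iff.1 (hN _ h1)).le
  -- `Q` does not increase along solutions, so `W` stays in the compact range `[η, ζ M]`.
  · obtain ⟨M, hM⟩ := (isCompact_closedBall (0 : E n) R).bddAbove_image
      hQ.1.continuous.continuousOn
    obtain ⟨c, hc, hc'⟩ := hρ.exists_pos_le hη (ζ M)
    refine ⟨c, hc, fun d x₀ hx₀ x hx t ht hWt => hc' _ ⟨hWt, (hWQ _).trans ?_⟩⟩
    have h1 := hx.le_sub_of_lieDeriv_le (c := 0) hQ.1 le_rfl ht fun s _ => by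
      simpa using hQdec (x s) (d s)
    rw [hx.apply_zero] at h1
    have h2 : Q x₀ ≤ M := hM (mem_image_of_mem Q (by simpa using hx₀))
    exact hζ.1.2.1.monotoneOn (hQ.2 _) ((hQ.2 _).trans (by linarith)) (by linarith)

theorem ClassK.le_of_apply_le {a : ℝ → ℝ} (ha : ClassK a) {s ε : ℝ} (hs : 0 ≤ s) (hε : 0 ≤ ε)
    (h : a s ≤ a ε) : s ≤ ε :=
  (ha.2.1.le_iff_le hs hε).1 h

theorem ClassK.pos {a : ℝ → ℝ} (ha : ClassK a) {s : ℝ} (hs : 0 < s) : 0 < a s := by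
  simpa [ha.2.2] using ha.2.1 (self_mem_Ici) hs.le hs

/-- Once `W` is below both `r` and `a ε`, the output stays below `ε`. -/
theorem IsSolution.norm_output_le {d : ℝ → D} {x₀ : E n} {x : ℝ → E n}
    (hx : IsSolution f d x₀ x) {W : E n → ℝ} (hW : ContDiff ℝ 1 W) {r : ℝ}
    (hWdec : ∀ x : E n, W x < r → ∀ d : D, lieDeriv f W x d ≤ 0) {h : E n → E k} {a : ℝ → ℝ}
    (ha : ClassK a) (hWh : ∀ x : E n, W x < r → a ‖h x‖ ≤ W x) {ε s t : ℝ} (hε : 0 ≤ ε)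
    (hs : 0 ≤ s) (hst : s ≤ t) (hr : W (x s) < r) (haε : W (x s) ≤ a ε) : ‖h (x t)‖ ≤ ε := by
  have h1 := hx.sublevel_antitone hW hWdec hs hst hr
  exact ha.le_of_apply_le (norm_nonneg _) hε ((hWh _ (h1.trans_lt hr)).trans (h1.trans haε))

theorem urgoa_of_dissipation {h : E n → E k} {V W : E n → ℝ} {ρ : ℝ → ℝ} (hV : C1Nonneg V)
    (hW : C1Nonneg W) (hρ : ContPosDef ρ)
    (hVdiss : ∀ (x : E n) (d : D), lieDeriv f V x d ≤ -ρ (W x)) {r : ℝ} (hr : 0 < r) {a : ℝ → ℝ}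
    (ha : ClassK a) (hWh : ∀ x : E n, W x < r → a ‖h x‖ ≤ W x)
    (hWdec : ∀ x : E n, W x < r → ∀ d : D, lieDeriv f W x d ≤ 0)
    (hcond :
      0 < liminf (fun s : ℝ => ((ρ s : ℝ) : EReal)) atTop ∨
      ∃ (ζ : ℝ → ℝ) (Q : E n → ℝ), ClassKInf ζ ∧ C1Nonneg Q ∧ (∀ x : E n, W x ≤ ζ (Q x)) ∧
        ∀ (x : E n) (d : D), lieDeriv f Q x d ≤ 0) :
    URGOA f h := by
  intro ε hε R hR
  obtain ⟨η, hη, hη'⟩ := exists_between (lt_min hr (ha.pos hε))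
  rw [lt_min_iff] at hη'
  obtain ⟨c, hc, hrate⟩ := exists_decay_rate hρ hcond hη R
  obtain ⟨M, hM⟩ := (isCompact_closedBall (0 : E n) R).bddAbove_image hV.1.continuous.continuousOn
  have hM0 : 0 ≤ M := (hV.2 0).trans (hM (mem_image_of_mem V (by simpa using hR.le)))
  -- If `W ≥ η` throughout this time, `V` would lose `M + 1`, more than its initial value.
  refine ⟨(M + 1) / c, by positivity, fun d _ x₀ hx₀ x hx t ht => ?_⟩
  have hT : 0 < (M + 1) / c := by positivity
  obtain ⟨s, hs, hsW⟩ : ∃ s ∈ Icc 0 ((M + 1) / c), W (x s) < η := by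
    by_contra! hge
    have h1 := hx.le_sub_of_lieDeriv_le (c := c) hV.1 le_rfl hT.le fun s hs =>
      (hVdiss (x s) (d s)).trans (neg_le_neg (hrate d x₀ hx₀ x hx s hs.1 (hge s hs)))
    have h2 : V x₀ ≤ M := hM (mem_image_of_mem V (by simpa using hx₀))
    rw [hx.apply_zero, sub_zero, mul_div_cancel₀ _ hc.ne'] at h1
    linarith [hV.2 (x ((M + 1) / c))]
  exact hx.norm_output_le hW.1 hWdec ha hWh hε.le hs.1 (hs.2.trans ht) (hsW.trans hη'.1)
    (hsW.trans hη'.2).le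

theorem lyapunovOutputStable_of_dissipation (hD : D.Nonempty) (hf0 : ∀ d : D, f (0, d) = 0)
    {h : E n → E k} {V W : E n → ℝ} {ρ : ℝ → ℝ}
    (hW : C1Nonneg W) (hρ : ContPosDef ρ)
    (hVdiss : ∀ (x : E n) (d : D), lieDeriv f V x d ≤ -ρ (W x)) {r : ℝ} (hr : 0 < r) {a : ℝ → ℝ}
    (ha : ClassK a) (hWh : ∀ x : E n, W x < r → a ‖h x‖ ≤ W x)
    (hWdec : ∀ x : E n, W x < r → ∀ d : D, lieDeriv f W x d ≤ 0) :
    LyapunovOutputStable f h := by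
  obtain ⟨d₀, hd₀⟩ := hD
  have hW0 : W 0 = 0 := by
    have h1 := hVdiss 0 ⟨d₀, hd₀⟩
    rw [lieDeriv, hf0, map_zero] at h1
    by_contra hne
    linarith [hρ.2.2 (W 0) (lt_of_le_of_ne (hW.2 0) (Ne.symm hne))]
  intro ε hε
  have hev : ∀ᶠ x in 𝓝 (0 : E n), W x < min r (a ε) :=
    hW.1.continuous.continuousAt.eventually_lt_const (by rw [hW0]; exact lt_min hr (ha.pos hε))
  obtain ⟨δ, hδ, hball⟩ := nhds_basis_closedBall.mem_iff.1 hev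
  refine ⟨δ, hδ, fun d _ x₀ hx₀ x hx t ht => ?_⟩
  have h1 : W x₀ < min r (a ε) := hball (by simpa using hx₀)
  rw [← hx.apply_zero, lt_min_iff] at h1
  exact hx.norm_output_le hW.1 hWdec ha hWh hε.le le_rfl ht h1.1 h1.2.le

end Attractivity

/-- Grönwall's inequality in integral form. -/
theorem le_mul_exp_of_le_add_integral {φ : ℝ → ℝ} {T δ L : ℝ} (hL : 0 ≤ L)
    (hφ : ContinuousOn φ (Icc 0 T)) (h : ∀ t ∈ Icc 0 T, φ t ≤ δ + L * ∫ s in (0 : ℝ)..t, φ s) :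
    ∀ t ∈ Icc 0 T, φ t ≤ δ * Real.exp (L * t) := by
  intro t ht
  have hT : 0 ≤ T := ht.1.trans ht.2
  have hint : IntervalIntegrable φ volume 0 T := hφ.intervalIntegrable_of_Icc hT
  -- The differential inequality is applied to the right-hand side, since `φ` itself need not be
  -- differentiable.
  have hcont : ContinuousOn (fun t => δ + L * ∫ s in (0 : ℝ)..t, φ s) (Icc 0 T) := by
    have h1 := intervalIntegral.continuousOn_primitive_interval' hint (left_mem_uIcc)
    rw [uIcc_of_le hT] at h1
    exact continuousOn_const.add (continuousOn_const.mul h1)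
  have hder : ∀ x ∈ Ico 0 T,
      HasDerivWithinAt (fun t => δ + L * ∫ s in (0 : ℝ)..t, φ s) (L * φ x) (Ici x) x := by
    intro x hx
    have hsub : Icc 0 T ∈ 𝓝[>] x :=
      mem_of_superset (Ioc_mem_nhdsGT hx.2) fun y hy => ⟨hx.1.trans hy.1.le, hy.2⟩
    have h1 : HasDerivWithinAt (fun t => ∫ s in (0 : ℝ)..t, φ s) (φ x) (Ici x) x := by
      refine intervalIntegral.integral_hasDerivWithinAt_right
        (hint.mono_set ?_) (t := Ioi x) ?_ ?_
      · rw [uIcc_of_le hT, uIcc_of_le hx.1]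
        exact Icc_subset_Icc_right hx.2.le
      · exact ⟨Icc 0 T, hsub, hφ.aestronglyMeasurable measurableSet_Icc⟩
      · exact ((hφ x (Ico_subset_Icc_self hx)).mono_of_mem_nhdsWithin hsub)
    simpa using (h1.const_mul L).const_add δ
  have key := le_gronwallBound_of_liminf_deriv_right_le (δ := δ) (K := L) (ε := 0) hcont
    (fun x hx r hr => (hder x hx).liminf_right_slope_le hr) (by simp)
    (fun x hx => by
      simpa using mul_le_mul_of_nonneg_left (h x (Ico_subset_Icc_self hx)) hL) t ht
  rw [gronwallBound_ε0, sub_zero] at key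
  exact (h t ht).trans key

/-! ### Dependence on initial states, and flow maps for compact input sets. -/

section Flow

variable {n m : ℕ} {D : Set (E m)} {f : E n × D → E n}

theorem IsSolution.shift {d : ℝ → D} {x₀ : E n} {x : ℝ → E n} (hx : IsSolution f d x₀ x) {a : ℝ}
    (ha : 0 ≤ a) : IsSolution f (fun t => d (t + a)) (x a) (fun t => x (t + a)) := by
  refine ⟨hx.1.comp (by fun_prop) fun t ht => add_nonneg ht ha, fun t ht => ⟨?_, ?_⟩⟩
  · simpa using (hx.intervalIntegrable ha (add_nonneg ht ha)).comp_add_right a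
  · rw [intervalIntegral.integral_comp_add_right (fun s => f (x s, d s)), zero_add]
    exact hx.eq_add_integral ha (add_nonneg ht ha)

theorem IsSolution.congr_input {d e : ℝ → D} {x₀ : E n} {x : ℝ → E n} (hx : IsSolution f d x₀ x)
    (hde : d =ᵐ[volume.restrict (Ici 0)] e) : IsSolution f e x₀ x := by
  refine ⟨hx.1, fun t ht => ?_⟩
  have hae : ∀ᵐ s, s ∈ uIoc 0 t → f (x s, d s) = f (x s, e s) := by
    filter_upwards [(ae_restrict_iff' measurableSet_Ici).1 hde] with s hs hmem
    rw [uIoc_of_le ht] at hmem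
    rw [hs hmem.1.le]
  refine ⟨(hx.2 t ht).1.congr_ae ((ae_restrict_iff' measurableSet_uIoc).2 hae), ?_⟩
  rw [← intervalIntegral.integral_congr_ae hae]
  exact (hx.2 t ht).2

/-- Solutions for inputs that agree on `[0,s)` diverge at most exponentially on `[0,s]`, with a small
displacement for short times. -/
theorem IsSolution.norm_sub_le {d e : ℝ → D} {x₀ y₀ : E n} {x y : ℝ → E n}
    (hx : IsSolution f d x₀ x) (hy : IsSolution f e y₀ y) {s : ℝ} (hde : EqOn d e (Ico 0 s))
    {S : Set (E n)} (hxS : MapsTo x (Icc 0 s) S) (hyS : MapsTo y (Icc 0 s) S) {L : ℝ} (hL : 0 ≤ L)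
    (hlip : ∀ x ∈ S, ∀ z ∈ S, ∀ d : D, ‖f (x, d) - f (z, d)‖ ≤ L * ‖x - z‖) {t : ℝ}
    (ht : t ∈ Icc 0 s) :
    ‖x t - y t‖ ≤ ‖x₀ - y₀‖ * Real.exp (L * t) ∧
      ‖x t - y t - (x₀ - y₀)‖ ≤ L * (‖x₀ - y₀‖ * Real.exp (L * t)) * t := by
  have hcont : ContinuousOn (fun τ => ‖x τ - y τ‖) (Icc 0 s) :=
    ((hx.1.sub hy.1).norm).mono fun _ h => h.1
  have h1 : ∀ t ∈ Icc 0 s, ‖x t - y t - (x₀ - y₀)‖ ≤ L * ∫ τ in (0 : ℝ)..t, ‖x τ - y τ‖ := by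
    intro t ht
    rw [(hx.2 t ht.1).2, (hy.2 t ht.1).2, add_sub_add_comm, add_sub_cancel_left,
      ← intervalIntegral.integral_sub (hx.2 t ht.1).1 (hy.2 t ht.1).1,
      ← intervalIntegral.integral_const_mul]
    have hne : ∀ᵐ τ : ℝ, τ ≠ s := by simp [ae_iff, measure_singleton]
    refine intervalIntegral.norm_integral_le_of_norm_le ht.1 ?_ ?_
    · filter_upwards [hne] with τ hτ hmem
      have hτs : τ ∈ Icc 0 s := ⟨hmem.1.le, hmem.2.trans ht.2⟩
      rw [← hde ⟨hτs.1, lt_of_le_of_ne hτs.2 hτ⟩]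
      exact hlip _ (hxS hτs) _ (hyS hτs) _
    · exact ((hcont.mono (Icc_subset_Icc_right ht.2)).intervalIntegrable_of_Icc ht.1).const_mul L
  have h2 := le_mul_exp_of_le_add_integral (δ := ‖x₀ - y₀‖) hL hcont fun t ht => by
    have := norm_sub_norm_le (x t - y t) (x₀ - y₀)
    linarith [h1 t ht]
  refine ⟨h2 t ht, (h1 t ht).trans ?_⟩
  rw [mul_assoc]
  refine mul_le_mul_of_nonneg_left ?_ hL
  have h3 := intervalIntegral.integral_mono_on ht.1
    ((hcont.mono (Icc_subset_Icc_right ht.2)).intervalIntegrable_of_Icc ht.1)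
    (intervalIntegrable_const (μ := volume) (c := ‖x₀ - y₀‖ * Real.exp (L * t))) fun τ hτ =>
      (h2 τ ⟨hτ.1, hτ.2.trans ht.2⟩).trans (by gcongr; exact hτ.2)
  rwa [intervalIntegral.integral_const, smul_eq_mul, sub_zero, mul_comm t] at h3

/-- A forward complete system with compact input set. -/
structure CompactSystem (f : E n × D → E n) : Prop where
  continuous : Continuous f
  lipschitz : LocLipState f
  compact : IsCompact D
  complete : ForwardComplete f

/-- The value at time `t` of the solution from `x` for the input `d`. -/
noncomputable def flow (f : E n × D → E n) (d : ℝ → D) (t : ℝ) (x : E n) : E n :=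
  Classical.epsilon (IsSolution f d x) t

/-- The input `u` up to time `s`, followed by `v`. -/
noncomputable def concat (u : ℝ → D) (s : ℝ) (v : ℝ → D) (t : ℝ) : D :=
  if t < s then u t else v (t - s)

theorem measurable_concat {u v : ℝ → D} (hu : Measurable u) (hv : Measurable v) (s : ℝ) :
    Measurable (concat u s v) :=
  Measurable.ite measurableSet_Iio hu (hv.comp (measurable_id.sub_const s))

namespace CompactSystem

theorem isInput (H : CompactSystem f) {d : ℝ → D} (hd : Measurable d) : IsInput d := by
  refine ⟨hd.aemeasurable, fun T => ?_⟩
  obtain ⟨M, hM⟩ := H.compact.isBounded.exists_norm_le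
  exact ⟨M, Eventually.of_forall fun t => hM _ (d t).2⟩

theorem exists_lipschitz (H : CompactSystem f) (R : ℝ) :
    ∃ L, 0 < L ∧ ∀ x ∈ closedBall (0 : E n) R, ∀ z ∈ closedBall (0 : E n) R, ∀ d : D,
      ‖f (x, d) - f (z, d)‖ ≤ L * ‖x - z‖ := by
  obtain ⟨L, hL, h⟩ := H.lipschitz _ (isCompact_closedBall 0 R) D subset_rfl H.compact.isBounded
  exact ⟨L, hL, fun x hx z hz d => h x hx z hz d d.2⟩

theorem exists_bound (H : CompactSystem f) (R : ℝ) :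
    ∃ B, 0 < B ∧ ∀ x ∈ closedBall (0 : E n) R, ∀ d : D, ‖f (x, d)‖ ≤ B := by
  have := isCompact_iff_compactSpace.1 H.compact
  obtain ⟨B, hB⟩ := ((isCompact_closedBall (0 : E n) R).prod
    (isCompact_univ (X := D))).exists_bound_of_continuousOn H.continuous.continuousOn
  exact ⟨max B 1, by positivity, fun x hx d => (hB (x, d) ⟨hx, mem_univ _⟩).trans (le_max_left _ _)⟩

theorem isSolution_flow (H : CompactSystem f) {d : ℝ → D} (hd : Measurable d) (x : E n) :
    IsSolution f d x (fun t => flow f d t x) :=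
  Classical.epsilon_spec (H.complete x d (H.isInput hd))

end CompactSystem

theorem IsSolution.exists_bound {d : ℝ → D} {x₀ : E n} {x : ℝ → E n} (hx : IsSolution f d x₀ x)
    (T : ℝ) : ∃ M, ∀ t ∈ Icc 0 T, ‖x t‖ ≤ M :=
  isCompact_Icc.exists_bound_of_continuousOn (hx.1.mono fun _ h => h.1)

namespace CompactSystem

/-- Solutions from the same state for inputs that agree on `[0,s)` agree on `[0,s]`. -/
theorem eqOn (H : CompactSystem f) {d e : ℝ → D} {x₀ : E n} {x y : ℝ → E n}
    (hx : IsSolution f d x₀ x) (hy : IsSolution f e x₀ y) {s : ℝ} (hde : EqOn d e (Ico 0 s)) :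
    EqOn x y (Icc 0 s) := by
  intro t ht
  obtain ⟨M, hM⟩ := hx.exists_bound s
  obtain ⟨N, hN⟩ := hy.exists_bound s
  obtain ⟨L, hL, hlip⟩ := H.exists_lipschitz (max M N)
  have h1 := (hx.norm_sub_le hy hde
    (fun τ hτ => mem_closedBall_zero_iff.2 ((hM τ hτ).trans (le_max_left _ _)))
    (fun τ hτ => mem_closedBall_zero_iff.2 ((hN τ hτ).trans (le_max_right _ _))) hL.le hlip ht).1
  rw [sub_self, norm_zero, zero_mul] at h1
  exact sub_eq_zero.1 (norm_le_zero_iff.1 h1)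

theorem flow_zero (H : CompactSystem f) {d : ℝ → D} (hd : Measurable d) (x : E n) :
    flow f d 0 x = x :=
  (H.isSolution_flow hd x).apply_zero

theorem flow_congr (H : CompactSystem f) {d e : ℝ → D} (hd : Measurable d) (he : Measurable e)
    {s : ℝ} (hs : 0 ≤ s) (hde : EqOn d e (Ico 0 s)) (x : E n) : flow f d s x = flow f e s x :=
  H.eqOn (H.isSolution_flow hd x) (H.isSolution_flow he x) hde ⟨hs, le_rfl⟩

theorem flow_add (H : CompactSystem f) {d : ℝ → D} (hd : Measurable d) {a b : ℝ} (ha : 0 ≤ a)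
    (hb : 0 ≤ b) (x : E n) :
    flow f d (a + b) x = flow f (fun t => d (t + a)) b (flow f d a x) := by
  rw [add_comm]
  exact H.eqOn ((H.isSolution_flow hd x).shift ha)
    (H.isSolution_flow (hd.comp (measurable_id.add_const a)) _) (fun _ _ => rfl) ⟨hb, le_rfl⟩

theorem flow_concat (H : CompactSystem f) {u v : ℝ → D} (hu : Measurable u) (hv : Measurable v)
    {s t : ℝ} (hs : 0 ≤ s) (ht : 0 ≤ t) (x : E n) :
    flow f (concat u s v) (s + t) x = flow f v t (flow f u s x) := by
  have hc := measurable_concat hu hv s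
  rw [H.flow_add hc hs ht, H.flow_congr hc hu hs fun τ hτ => by simp [concat, hτ.2]]
  refine H.flow_congr (hc.comp (measurable_id.add_const s)) hv ht (fun τ hτ => ?_) _
  simp [concat, not_lt.2 hτ.1]

/-- Up to the first time at norm `R + 1` the speed is at most `B`, so the distance covered is at
most `B * σ < 1`, too little to get there. -/
theorem norm_flow_le (H : CompactSystem f) {R B σ : ℝ} (hσ : B * σ < 1) (hB : 0 < B)
    (hf : ∀ x ∈ closedBall (0 : E n) (R + 1), ∀ d : D, ‖f (x, d)‖ ≤ B)
    {d : ℝ → D} (hd : Measurable d) {x : E n} (hx : ‖x‖ ≤ R) {t : ℝ} (ht : t ∈ Icc 0 σ) :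
    ‖flow f d t x‖ ≤ R + 1 := by
  have hsol := H.isSolution_flow hd x
  by_contra! hlt
  have hcont : ContinuousOn (fun τ => ‖flow f d τ x‖) (Icc 0 t) :=
    (hsol.1.mono fun _ h => h.1).norm
  have hcl : IsCompact (Icc 0 t ∩ (fun τ => ‖flow f d τ x‖) ⁻¹' {R + 1}) :=
    isCompact_Icc.of_isClosed_subset
      (hcont.preimage_isClosed_of_isClosed isClosed_Icc isClosed_singleton) inter_subset_left
  have h0 : ‖flow f d 0 x‖ ≤ R + 1 := by rw [H.flow_zero hd]; linarith
  obtain ⟨τ₀, hτ₀, hτ₀'⟩ := intermediate_value_Icc ht.1 hcont ⟨h0, hlt.le⟩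
  obtain ⟨τ, ⟨hτ, hτR⟩, hleast⟩ := hcl.exists_isLeast ⟨τ₀, hτ₀, hτ₀'⟩
  have hτR' : ‖flow f d τ x‖ = R + 1 := hτR
  have hin : ∀ s ∈ Icc 0 τ, ‖flow f d s x‖ ≤ R + 1 := by
    intro s hs
    by_contra! hgt
    obtain ⟨s', hs', hs'R⟩ := intermediate_value_Icc hs.1
      (hcont.mono (Icc_subset_Icc_right (hs.2.trans hτ.2))) ⟨h0, hgt.le⟩
    have h1 : s = τ :=
      le_antisymm hs.2 ((hleast ⟨⟨hs'.1, hs'.2.trans (hs.2.trans hτ.2)⟩, hs'R⟩).trans hs'.2)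
    rw [h1, hτR'] at hgt
    exact lt_irrefl _ hgt
  have h2 : ‖∫ s in (0 : ℝ)..τ, f (flow f d s x, d s)‖ ≤ B * |τ - 0| := by
    refine intervalIntegral.norm_integral_le_of_norm_le_const fun s hs => ?_
    rw [uIoc_of_le hτ.1] at hs
    exact hf _ (mem_closedBall_zero_iff.2 (hin s ⟨hs.1.le, hs.2⟩)) _
  have h3 : flow f d τ x = x + ∫ s in (0 : ℝ)..τ, f (flow f d s x, d s) := (hsol.2 τ hτ.1).2
  rw [sub_zero, abs_of_nonneg hτ.1] at h2
  have h4 : B * τ ≤ B * σ := mul_le_mul_of_nonneg_left (hτ.2.trans ht.2) hB.le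
  have h5 := norm_add_le x (∫ s in (0 : ℝ)..τ, f (flow f d s x, d s))
  rw [← h3, hτR'] at h5
  linarith

/-- For short times, uniformly over all inputs, solutions from a ball stay bounded and the flow maps
are close to the identity. -/
theorem exists_short_time (H : CompactSystem f) (R : ℝ) :
    ∃ σ, 0 < σ ∧ ∀ d : ℝ → D, Measurable d → ∀ t ∈ Icc 0 σ,
      (∀ x, ‖x‖ ≤ R → ‖flow f d t x‖ ≤ R + 1) ∧
      ApproximatesLinearOn (flow f d t) (ContinuousLinearMap.id ℝ (E n)) (closedBall 0 R)
        (1 / 2) := by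
  obtain ⟨B, hB, hfB⟩ := H.exists_bound (R + 1)
  obtain ⟨L, hL, hlip⟩ := H.exists_lipschitz (R + 1)
  -- The first term confines solutions to radius `R + 1`. The second gives `L * t * exp (L * t) ≤ 1
  -- / 6 * 3 = 1 / 2`.
  have hσ : 0 < min (1 / (2 * B)) (1 / (6 * L)) := by positivity
  have h1 : B * min (1 / (2 * B)) (1 / (6 * L)) < 1 := by
    refine (mul_le_mul_of_nonneg_left (min_le_left _ _) hB.le).trans_lt ?_
    field_simp
    norm_num
  have h2 : L * min (1 / (2 * B)) (1 / (6 * L)) ≤ 1 / 6 := by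
    refine (mul_le_mul_of_nonneg_left (min_le_right _ _) hL.le).trans_eq ?_
    field_simp
  refine ⟨_, hσ, fun d hd t ht => ⟨fun x hx => H.norm_flow_le h1 hB hfB hd hx ht, ?_⟩⟩
  intro x hx y hy
  rw [mem_closedBall_zero_iff] at hx hy
  have h3 := ((H.isSolution_flow hd x).norm_sub_le (H.isSolution_flow hd y) (s := t)
    (fun _ _ => rfl)
    (fun τ hτ => mem_closedBall_zero_iff.2
      (H.norm_flow_le h1 hB hfB hd hx ⟨hτ.1, hτ.2.trans ht.2⟩))
    (fun τ hτ => mem_closedBall_zero_iff.2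
      (H.norm_flow_le h1 hB hfB hd hy ⟨hτ.1, hτ.2.trans ht.2⟩)) hL.le hlip ⟨ht.1, le_rfl⟩).2
  refine h3.trans ?_
  have h4 : L * t ≤ 1 / 6 := (mul_le_mul_of_nonneg_left ht.2 hL.le).trans h2
  have h5 : Real.exp (L * t) ≤ 3 :=
    (Real.exp_le_exp.2 (h4.trans (by norm_num))).trans (Real.exp_one_lt_d9.le.trans (by norm_num))
  calc L * (‖x - y‖ * Real.exp (L * t)) * t = (L * t) * Real.exp (L * t) * ‖x - y‖ := by ring
    _ ≤ 1 / 6 * 3 * ‖x - y‖ := by gcongr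
    _ = ((1 / 2 : NNReal) : ℝ) * ‖x - y‖ := by push_cast; ring

end CompactSystem

end Flow

/-- The identity as a nonlinear right inverse of the identity, with constant `1`. -/
def idRightInverse (F : Type*) [NormedAddCommGroup F] [NormedSpace ℝ F] :
    (ContinuousLinearMap.id ℝ F).NonlinearRightInverse where
  toFun := id
  nnnorm := 1
  bound' := by simp
  right_inv' := by simp

/-! ### Bounded reachable sets by a nested escape construction. -/

section Reachability

variable {n m : ℕ} {D : Set (E m)} {f : E n × D → E n}

/-- The points reachable from `A` up to time `T`. -/
def reach (f : E n × D → E n) (A : Set (E n)) (T : ℝ) : Set (E n) :=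
  {y | ∃ d : ℝ → D, Measurable d ∧ ∃ x ∈ A, ∃ t ∈ Icc 0 T, flow f d t x = y}

theorem reach_mono {A B : Set (E n)} (hAB : A ⊆ B) (T : ℝ) : reach f A T ⊆ reach f B T :=
  fun _ ⟨d, hd, x, hx, h⟩ => ⟨d, hd, x, hAB hx, h⟩

theorem reach_union (A B : Set (E n)) (T : ℝ) :
    reach f (A ∪ B) T ⊆ reach f A T ∪ reach f B T := by
  rintro _ ⟨d, hd, x, hx | hx, h⟩
  exacts [Or.inl ⟨d, hd, x, hx, h⟩, Or.inr ⟨d, hd, x, hx, h⟩]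

/-- Solutions from states arbitrarily near `x` get arbitrarily far up to time `T`. -/
def EscapesNear (f : E n × D → E n) (x : E n) (T : ℝ) : Prop :=
  ∀ U ∈ 𝓝 x, ¬ Bornology.IsBounded (reach f U T)

theorem exists_escapesNear {K : Set (E n)} (hK : IsCompact K) {T : ℝ}
    (h : ¬ Bornology.IsBounded (reach f K T)) : ∃ x ∈ K, EscapesNear f x T := by
  by_contra! hne
  refine h (hK.induction_on (p := fun s => Bornology.IsBounded (reach f s T)) ?_ ?_ ?_ ?_)
  · refine Bornology.isBounded_empty.subset ?_
    rintro _ ⟨d, hd, x, hx, h⟩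
    exact hx.elim
  · exact fun s t hst ht => ht.subset (reach_mono hst T)
  · exact fun s t hs ht => (hs.union ht).subset (reach_union s t T)
  · intro x hx
    obtain ⟨U, hU, hb⟩ := by simpa [EscapesNear] using hne x hx
    exact ⟨U, mem_nhdsWithin_of_mem_nhds hU, hb⟩

theorem EscapesNear.nonneg {x : E n} {T : ℝ} (h : EscapesNear f x T) : 0 ≤ T := by
  by_contra! hT
  refine h univ univ_mem (Bornology.isBounded_empty.subset ?_)
  rintro _ ⟨d, hd, x, hx, t, ht, h⟩
  exact absurd (ht.1.trans ht.2) (not_le.2 hT)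

namespace CompactSystem

/-- Flow maps are continuous and open. -/
theorem map_nhds_flow (H : CompactSystem f) {d : ℝ → D} (hd : Measurable d) {T : ℝ} (hT : 0 ≤ T)
    (x : E n) : map (flow f d T) (𝓝 x) = 𝓝 (flow f d T x) := by
  obtain ⟨M, hM⟩ := (H.isSolution_flow hd x).exists_bound T
  -- Radius `M + 1` makes the ball a neighbourhood of every point of the trajectory, so one step
  -- length `σ` serves all along it.
  obtain ⟨σ, hσ, hshort⟩ := H.exists_short_time (M + 1)
  have key : ∀ N : ℕ, ∀ t ∈ Icc 0 T, t ≤ N * σ →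
      map (flow f d t) (𝓝 x) = 𝓝 (flow f d t x) := by
    intro N
    induction N with
    | zero =>
      intro t ht htN
      obtain rfl : t = 0 := le_antisymm (by simpa using htN) ht.1
      rw [show flow f d 0 = id from funext fun y => H.flow_zero hd y, map_id, id]
    | succ N ih =>
      intro t ht htN
      rcases le_total t σ with htσ | htσ
      · exact ((hshort d hd t ⟨ht.1, htσ⟩).2).map_nhds_eq (idRightInverse (E n))
          (closedBall_mem_nhds_of_mem (by
            have := hM 0 ⟨le_rfl, hT⟩
            rw [H.flow_zero hd] at this
            simpa using this.trans_lt (lt_add_one M)))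
          (Or.inr (by rw [← NNReal.coe_lt_coe]; norm_num [idRightInverse]))
      · have ha : 0 ≤ t - σ := sub_nonneg.2 htσ
        have haT : t - σ ∈ Icc 0 T := ⟨ha, by linarith [ht.2]⟩
        have h1 := ih (t - σ) haT (by push_cast at htN; linarith)
        have hcomp : flow f d t = flow f (fun τ => d (τ + (t - σ))) σ ∘ flow f d (t - σ) := by
          funext y
          rw [Function.comp, ← H.flow_add hd ha hσ.le, sub_add_cancel]
        have h2 := ((hshort _ (hd.comp (measurable_id.add_const (t - σ))) σ
          ⟨hσ.le, le_rfl⟩).2).map_nhds_eq (idRightInverse (E n)) (x := flow f d (t - σ) x)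
          (closedBall_mem_nhds_of_mem (by simpa using (hM _ haT).trans_lt (lt_add_one M)))
          (Or.inr (by rw [← NNReal.coe_lt_coe]; norm_num [idRightInverse]))
        rw [hcomp, ← Filter.map_map, h1]
        exact h2
  obtain ⟨N, hN⟩ := exists_nat_ge (T / σ)
  exact key N T ⟨hT, le_rfl⟩ ((div_le_iff₀ hσ).1 hN)

/-- If solutions escape near `x`, then after a short time they still escape near some state that is
exactly reachable from a state close to `x`. -/
theorem exists_escapesNear_step (H : CompactSystem f) (R : ℝ) :
    ∃ σ, 0 < σ ∧ ∀ x T, ‖x‖ ≤ R → EscapesNear f x T → ∀ U ∈ 𝓝 x,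
      σ ≤ T ∧ ∃ y ∈ U, ∃ d : ℝ → D, Measurable d ∧ EscapesNear f (flow f d σ y) (T - σ) := by
  obtain ⟨σ, hσ, hshort⟩ := H.exists_short_time (R + 1)
  refine ⟨σ, hσ, fun x T hx hesc U hU => ?_⟩
  obtain ⟨η, hη, hηU⟩ := nhds_basis_closedBall.mem_iff.1
    (inter_mem hU (closedBall_mem_nhds x one_pos))
  have hηR : closedBall x η ⊆ closedBall 0 (R + 1) := by
    refine (hηU.trans inter_subset_right).trans (closedBall_subset_closedBall' ?_)
    rw [dist_zero_right]
    linarith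
  have hsub : closedBall x (η / 4) ⊆ closedBall x η :=
    closedBall_subset_closedBall (by linarith)
  have hA := hesc _ (closedBall_mem_nhds x (show 0 < η / 4 by linarith))
  have hsmall : ∀ d : ℝ → D, Measurable d → ∀ y ∈ closedBall x (η / 4), ∀ t ∈ Icc 0 σ,
      flow f d t y ∈ closedBall (0 : E n) (R + 1 + 1) := fun d hd y hy t ht =>
    mem_closedBall_zero_iff.2
      ((hshort d hd t ht).1 y (mem_closedBall_zero_iff.1 (hηR (hsub hy))))
  have hσT : σ ≤ T := by
    by_contra! hlt
    refine hA ((isBounded_closedBall (x := (0 : E n)) (r := R + 1 + 1)).subset ?_)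
    rintro _ ⟨d, hd, y, hy, t, ht, rfl⟩
    exact hsmall d hd y hy t ⟨ht.1, ht.2.trans hlt.le⟩
  refine ⟨hσT, ?_⟩
  set Z : Set (E n) := {z | ∃ d : ℝ → D, Measurable d ∧ ∃ y ∈ closedBall x (η / 4),
    flow f d σ y = z} with hZ
  have hZb : Bornology.IsBounded Z := by
    refine (isBounded_closedBall (x := (0 : E n)) (r := R + 1 + 1)).subset ?_
    rintro _ ⟨d, hd, y, hy, rfl⟩
    exact hsmall d hd y hy σ ⟨hσ.le, le_rfl⟩
  -- Up to time `σ` all solutions stay in a ball, so the escape must happen after passing through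
  -- `Z`.
  have hZesc : ¬ Bornology.IsBounded (reach f (closure Z) (T - σ)) := by
    intro hb
    refine hA ((isBounded_closedBall (x := (0 : E n)) (r := R + 1 + 1)).union hb |>.subset ?_)
    rintro _ ⟨d, hd, y, hy, t, ht, rfl⟩
    rcases le_total t σ with htσ | htσ
    · exact Or.inl (hsmall d hd y hy t ⟨ht.1, htσ⟩)
    · refine Or.inr ⟨_, hd.comp (measurable_id.add_const σ), _,
        subset_closure ⟨d, hd, y, hy, rfl⟩, t - σ, ⟨sub_nonneg.2 htσ, by linarith [ht.2]⟩, ?_⟩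
      have := H.flow_add hd hσ.le (sub_nonneg.2 htσ) y
      rw [add_sub_cancel] at this
      exact this.symm
  obtain ⟨p, hpZ, hp⟩ := exists_escapesNear hZb.isCompact_closure hZesc
  -- `p` is only a limit of reached states. The flow map is within `1 / 2` of the identity, so the
  -- image of the ball of radius `η / 2` about `y` covers the ball of radius `η / 4` about its
  -- image, and `p` is reached exactly.
  obtain ⟨_, ⟨d, hd, y, hy, rfl⟩, hdist⟩ :=
    Metric.mem_closure_iff.1 hpZ (η / 4) (by linarith)
  have hball : closedBall y (η / 2) ⊆ closedBall x η :=
    closedBall_subset_closedBall' (by have := mem_closedBall.1 hy; linarith)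
  have hsurj := ((hshort d hd σ ⟨hσ.le, le_rfl⟩).2).surjOn_closedBall_of_nonlinearRightInverse
    (idRightInverse (E n)) (show 0 ≤ η / 2 by linarith) (hball.trans hηR)
  obtain ⟨y', hy', rfl⟩ := hsurj (show p ∈ closedBall (flow f d σ y) _ by
    rw [mem_closedBall]
    refine hdist.le.trans_eq ?_
    norm_num [idRightInverse]
    ring)
  exact ⟨y', (hηU (hball hy')).1, d, hd, hp⟩

/-- Each short step taken inside norm `R` costs time `σ`, and escape needs nonnegative remaining
time, so norm `R` is attained after finitely many steps. Openness of the flow maps pulls the state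
found back to an initial state in `U`. -/
theorem exists_escapesNear_far (H : CompactSystem f) (hD : D.Nonempty) (R : ℝ) {x : E n} {T : ℝ}
    (hx : EscapesNear f x T) {U : Set (E n)} (hU : U ∈ 𝓝 x) :
    ∃ y ∈ U, ∃ d : ℝ → D, Measurable d ∧ ∃ s, 0 ≤ s ∧ R ≤ ‖flow f d s y‖ ∧
      EscapesNear f (flow f d s y) (T - s) := by
  obtain ⟨d₀, hd₀⟩ := hD
  obtain ⟨σ, hσ, hstep⟩ := H.exists_escapesNear_step R
  have hfar : ∀ x T, EscapesNear f x T → ∀ U ∈ 𝓝 x, R ≤ ‖x‖ →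
      ∃ y ∈ U, ∃ d : ℝ → D, Measurable d ∧ ∃ s, 0 ≤ s ∧ R ≤ ‖flow f d s y‖ ∧
        EscapesNear f (flow f d s y) (T - s) := by
    intro x T hx U hU hR
    have hc : Measurable (fun _ : ℝ => (⟨d₀, hd₀⟩ : D)) := measurable_const
    refine ⟨x, mem_of_mem_nhds hU, _, hc, 0, le_rfl, ?_⟩
    rw [H.flow_zero hc, sub_zero]
    exact ⟨hR, hx⟩
  have key : ∀ N : ℕ, ∀ x T, EscapesNear f x T → ∀ U ∈ 𝓝 x, T < N * σ →
      ∃ y ∈ U, ∃ d : ℝ → D, Measurable d ∧ ∃ s, 0 ≤ s ∧ R ≤ ‖flow f d s y‖ ∧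
        EscapesNear f (flow f d s y) (T - s) := by
    intro N
    induction N with
    | zero =>
      intro x T hx U hU hT
      exact absurd hx.nonneg (not_le.2 (by simpa using hT))
    | succ N ih =>
      intro x T hx U hU hT
      rcases le_total R ‖x‖ with hR | hR
      · exact hfar x T hx U hU hR
      obtain ⟨-, y, hy, d, hd, hesc⟩ := hstep x T hR hx (interior U) (interior_mem_nhds.2 hU)
      have himg : flow f d σ '' interior U ∈ 𝓝 (flow f d σ y) := by
        rw [← H.map_nhds_flow hd hσ.le]
        exact image_mem_map (isOpen_interior.mem_nhds hy)
      obtain ⟨_, ⟨z, hz, rfl⟩, e, he, s, hs, hR', hesc'⟩ :=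
        ih _ _ hesc _ himg (by push_cast at hT; linarith)
      refine ⟨z, interior_subset hz, _, measurable_concat hd he σ, σ + s, by positivity, ?_⟩
      rw [H.flow_concat hd he hσ.le hs, ← sub_sub]
      exact ⟨hR', hesc'⟩
  obtain ⟨N, hN⟩ := exists_nat_gt (T / σ)
  exact key N x T hx U hU ((div_lt_iff₀ hσ).1 hN)

/-- Inputs that extend each other on increasing time intervals have a common extension. -/
theorem _root_.exists_measurable_extension {α : Type*} [TopologicalSpace α]
    [TopologicalSpace.PseudoMetrizableSpace α] [MeasurableSpace α] [BorelSpace α] [Nonempty α]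
    {u : ℕ → ℝ → α} (hu : ∀ j, Measurable (u j)) {s : ℕ → ℝ}
    (hext : ∀ i j, i ≤ j → s i ≤ s j ∧ EqOn (u i) (u j) (Iio (s i))) :
    ∃ v : ℝ → α, Measurable v ∧ ∀ j, EqOn v (u j) (Iio (s j)) := by
  obtain ⟨e⟩ := ‹Nonempty α›
  -- Filling with `e` beyond `s j` makes the inputs eventually constant at every `t`, even past all
  -- `s j`; their pointwise limit is therefore measurable.
  have hlim : ∀ t, ∃ b, ∀ᶠ j in atTop, (if t < s j then u j t else e) = b := by
    intro t
    by_cases h : ∃ i, t < s i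
    · obtain ⟨i, hi⟩ := h
      refine ⟨u i t, eventually_atTop.2 ⟨i, fun j hij => ?_⟩⟩
      rw [if_pos (hi.trans_le (hext i j hij).1)]
      exact ((hext i j hij).2 hi).symm
    · push Not at h
      exact ⟨e, Eventually.of_forall fun j => if_neg (not_lt.2 (h j))⟩
  choose v hv using hlim
  refine ⟨v, ?_, fun i t ht => ?_⟩
  · refine measurable_of_tendsto_metrizable (f := fun j t => if t < s j then u j t else e)
      (fun j => Measurable.ite measurableSet_Iio (hu j) measurable_const)
      (tendsto_pi_nhds.2 fun t => tendsto_const_nhds.congr' ?_)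
    filter_upwards [hv t] with j hj using hj.symm
  · obtain ⟨j, hj, hij⟩ := ((hv t).and (eventually_ge_atTop i)).exists
    rw [if_pos (lt_of_lt_of_le ht (hext i j hij).1)] at hj
    rw [← hj]
    exact ((hext i j hij).2 ht).symm

/-- A compact set of initial states together with an input up to a time `time`, such that solutions
still escape before time `T` near some state reached. -/
structure EscapeStage (f : E n × D → E n) (T : ℝ) where
  states : Set (E n)
  input : ℝ → D
  time : ℝ
  isCompact_states : IsCompact states
  measurable_input : Measurable input
  time_nonneg : 0 ≤ time
  escapes : ∃ x ∈ interior states, EscapesNear f (flow f input time x) (T - time)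

/-- Openness of the flow map realises the far escape from inside `q.states`; continuity then spreads
the norm bound to a closed ball of initial states. -/
theorem exists_next_escapeStage (H : CompactSystem f) (hD : D.Nonempty) {T : ℝ}
    (q : EscapeStage f T) (R : ℝ) :
    ∃ q' : EscapeStage f T, q'.states ⊆ q.states ∧ q.time ≤ q'.time ∧
      EqOn q.input q'.input (Iio q.time) ∧
      ∀ x ∈ q'.states, R < ‖flow f q'.input q'.time x‖ := by
  obtain ⟨x, hx, hesc⟩ := q.escapes
  have himg : flow f q.input q.time '' interior q.states ∈ 𝓝 (flow f q.input q.time x) := by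
    rw [← H.map_nhds_flow q.measurable_input q.time_nonneg]
    exact image_mem_map (isOpen_interior.mem_nhds hx)
  obtain ⟨_, ⟨y, hy, rfl⟩, e, he, s, hs, hR, hesc'⟩ :=
    H.exists_escapesNear_far hD (R + 1) hesc himg
  have hm := measurable_concat q.measurable_input he q.time
  have hflow := H.flow_concat q.measurable_input he q.time_nonneg hs y
  have hqs := add_nonneg q.time_nonneg hs
  have hcont : Tendsto (flow f (concat q.input q.time e) (q.time + s)) (𝓝 y)
      (𝓝 (flow f (concat q.input q.time e) (q.time + s) y)) := (H.map_nhds_flow hm hqs y).le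
  have hnear : ∀ᶠ z in 𝓝 y, R < ‖flow f (concat q.input q.time e) (q.time + s) z‖ :=
    hcont.norm.eventually_const_lt (by rw [hflow]; linarith)
  obtain ⟨η, hη, hsub⟩ := nhds_basis_closedBall.mem_iff.1
    (inter_mem (isOpen_interior.mem_nhds hy) hnear)
  refine ⟨⟨closedBall y η, concat q.input q.time e, q.time + s, isCompact_closedBall _ _, hm, hqs,
    y, mem_interior_iff_mem_nhds.2 (closedBall_mem_nhds y hη), ?_⟩, ?_, ?_, ?_, ?_⟩
  · rw [hflow, ← sub_sub]
    exact hesc'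
  · exact fun z hz => interior_subset (hsub hz).1
  · exact le_add_of_nonneg_right hs
  · intro t ht
    exact (if_pos ht).symm
  · exact fun z hz => (hsub hz).2

theorem not_escapesNear (H : CompactSystem f) (hD : D.Nonempty) (x : E n) (T : ℝ) :
    ¬ EscapesNear f x T := by
  intro hx
  have : Nonempty D := hD.to_subtype
  choose next hstates htime hinput hfar using
    fun (q : EscapeStage f T) (j : ℕ) => H.exists_next_escapeStage hD q j
  have hc : Measurable (fun _ : ℝ => (Classical.arbitrary D)) := measurable_const
  let q₀ : EscapeStage f T := ⟨closedBall x 1, _, 0, isCompact_closedBall _ _, hc, le_rfl, x,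
    mem_interior_iff_mem_nhds.2 (closedBall_mem_nhds x one_pos), by
      rw [H.flow_zero hc, sub_zero]
      exact hx⟩
  let q : ℕ → EscapeStage f T := fun j => Nat.rec q₀ (fun j p => next p j) j
  have hnonempty : ∀ j, (q j).states.Nonempty := fun j =>
    let ⟨y, hy, _⟩ := (q j).escapes
    ⟨y, interior_subset hy⟩
  obtain ⟨z, hz⟩ := IsCompact.nonempty_iInter_of_sequence_nonempty_isCompact_isClosed
    (fun j => (q j).states) (fun j => hstates (q j) j) hnonempty (q 0).isCompact_states
    fun j => (q j).isCompact_states.isClosed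
  rw [mem_iInter] at hz
  have hext : ∀ i j, i ≤ j →
      (q i).time ≤ (q j).time ∧ EqOn (q i).input (q j).input (Iio (q i).time) := by
    intro i j hij
    induction j, hij using Nat.le_induction with
    | base => exact ⟨le_rfl, fun _ _ => rfl⟩
    | succ j _ ih =>
      exact ⟨ih.1.trans (htime (q j) j), fun t ht =>
        (ih.2 ht).trans (hinput (q j) j (lt_of_lt_of_le ht ih.1))⟩
  obtain ⟨v, hv, hvq⟩ := exists_measurable_extension (fun j => (q j).measurable_input) hext
  obtain ⟨M, hM⟩ := (H.isSolution_flow hv z).exists_bound T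
  obtain ⟨j, hj⟩ := exists_nat_ge M
  have htT : (q (j + 1)).time ≤ T := by
    obtain ⟨y, -, hy⟩ := (q (j + 1)).escapes
    linarith [hy.nonneg]
  -- The solution from `z` under `v` is bounded by `M ≤ j` up to `T`, yet it exceeds `j` at the time
  -- of stage `j + 1`.
  have h1 := hM _ ⟨(q (j + 1)).time_nonneg, htT⟩
  have h2 := hfar (q j) j z (hz (j + 1))
  have h3 := H.flow_congr hv (q (j + 1)).measurable_input (q (j + 1)).time_nonneg
    (fun t ht => hvq (j + 1) ht.2) z
  rw [h3] at h1
  exact absurd (h2.trans_le (h1.trans hj)) (lt_irrefl _)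

/-- A forward complete system with compact input set has bounded reachability sets. -/
theorem exists_bound_solution (H : CompactSystem f) (hD : D.Nonempty) (R T : ℝ) :
    ∃ M, ∀ d : ℝ → D, IsInput d → ∀ x₀ : E n, ‖x₀‖ ≤ R → ∀ x : ℝ → E n, IsSolution f d x₀ x →
      ∀ t ∈ Icc 0 T, ‖x t‖ ≤ M := by
  have hb : Bornology.IsBounded (reach f (closedBall 0 R) T) := by
    by_contra hb
    obtain ⟨x, -, hx⟩ := exists_escapesNear (isCompact_closedBall 0 R) hb
    exact H.not_escapesNear hD x T hx
  obtain ⟨M, hM⟩ := hb.exists_norm_le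
  refine ⟨M, fun d hd x₀ hx₀ x hx t ht => hM _ ?_⟩
  -- `reach` admits only measurable inputs; changing the input on a null set does not affect the
  -- solution.
  have hm := hd.1.measurable_mk
  exact ⟨_, hm, x₀, mem_closedBall_zero_iff.2 hx₀, t, ht,
    H.eqOn (H.isSolution_flow hm x₀) (hx.congr_input hd.1.ae_eq_mk) (fun _ _ => rfl)
      ⟨ht.1, le_rfl⟩⟩

theorem lagrangeOutputStable {k : ℕ} (H : CompactSystem f) (hD : D.Nonempty) {h : E n → E k}
    (hh : Continuous h) (hattr : URGOA f h) : LagrangeOutputStable f h := by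
  intro δ hδ
  obtain ⟨T, hT, hTle⟩ := hattr 1 one_pos δ hδ
  obtain ⟨M, hM⟩ := H.exists_bound_solution hD δ T
  obtain ⟨C, hC⟩ := (isCompact_closedBall (0 : E n) M).exists_bound_of_continuousOn
    hh.continuousOn
  refine ⟨max C 1, by positivity, fun d hd x₀ hx₀ x hx t ht => ?_⟩
  rcases le_total t T with htT | htT
  · exact (hC _ (mem_closedBall_zero_iff.2 (hM d hd x₀ hx₀ x hx t ⟨ht, htT⟩))).trans
      (le_max_left _ _)
  · exact (hTle d hd x₀ hx₀ x hx t htT).trans (le_max_right _ _)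

end CompactSystem

end Reachability

end OutputStability

theorem theorem1 {n m k : ℕ} (D : Set (OutputStability.E m)) (hD : D.Nonempty)
    (f : OutputStability.E n × D → OutputStability.E n)
    (hf : Continuous f) (hfLip : OutputStability.LocLipState f)
    (hf0 : ∀ d : D, f (0, d) = 0)
    (h : OutputStability.E n → OutputStability.E k) (hh : Continuous h) (hh0 : h 0 = 0)
    (hfc : OutputStability.ForwardComplete f)
    (V W : OutputStability.E n → ℝ)
    (hV : OutputStability.C1Nonneg V) (hW : OutputStability.C1Nonneg W)
    (ρ : ℝ → ℝ) (hρ : OutputStability.ContPosDef ρ)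
    (hVdiss : ∀ (x : OutputStability.E n) (d : D),
      OutputStability.lieDeriv f V x d ≤ -ρ (W x))
    (r : ℝ) (hr : 0 < r) (a : ℝ → ℝ) (ha : OutputStability.ClassK a)
    (hWh : ∀ x : OutputStability.E n, W x < r → a ‖h x‖ ≤ W x)
    (hWdec : ∀ x : OutputStability.E n, W x < r → ∀ d : D,
      OutputStability.lieDeriv f W x d ≤ 0)
    (hcond :
      0 < liminf (fun s : ℝ => ((ρ s : ℝ) : EReal)) atTop ∨
      ∃ (ζ : ℝ → ℝ) (Q : OutputStability.E n → ℝ),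
        OutputStability.ClassKInf ζ ∧ OutputStability.C1Nonneg Q ∧
        (∀ x : OutputStability.E n, W x ≤ ζ (Q x)) ∧
        ∀ (x : OutputStability.E n) (d : D), OutputStability.lieDeriv f Q x d ≤ 0) :
    (OutputStability.URGOA f h ∧ OutputStability.LyapunovOutputStable f h) ∧
    (OutputStability.CompactLipschitz f → OutputStability.URGAOS f h) := by
  have hattr := OutputStability.urgoa_of_dissipation hV hW hρ hVdiss hr ha hWh hWdec hcond
  have hlyap := OutputStability.lyapunovOutputStable_of_dissipation hD hf0 hW hρ hVdiss hr ha hWh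
    hWdec
  exact ⟨⟨hattr, hlyap⟩, fun hc =>
    ⟨OutputStability.CompactSystem.lagrangeOutputStable ⟨hf, hfLip, hc.1, hfc⟩ hD hh hattr,
      hlyap, hattr⟩⟩
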